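/- Let $\mathbb N=\{1,2,\dots\}$, let $F_1=1$, $F_2=2$, $F_{n+2}=F_{n+1}+F_n$, let $\phi$ be the golden ratio and $\omega=\phi^{-1}$. For a condition $P$ put $\mathrm{Prob}\{n\in\mathbb N:P(n)\}=\lim_{n\to\infty}\frac1n\#\{k\le n:P(k)\}$. If $m=\sum_{k=1}^{M}a_kF_{M-k+1}$ is the Zeckendorf expansion of a positive integer $m$ ($a_k\in\{0,1\}$, $a_1=1$, $a_ka_{k+1}=0$), then $\mathrm{LB}_s(m)=(a_1,\dots,a_s)$ if $s\le M$, and $\mathrm{LB}_s(m)$ is undefined if $s>M$. Let $\mathcal F_s$ be the set of tuples $b\in\{0,1\}^s$ with $b_1=1$ and $b_kb_{k+1}=0$ for $1\le k<s$, ordered by $b<c$ iff $\sum_{k\le s} b_k\omega^{k-1}<\sum_{k\le s} c_k\omega^{k-1}$. Let $\mathcal F^*$ be the set of infinite sequences $\mu$ in $\{0,1\}$ with $\mu(k)\mu(k+1)=0$ for all $k\ge1$ and no tail equal to $(1,0,1,0,\dots)$; write $\mu|s=(\mu(1),\dots,\mu(s))$. Let $K=(K_n)_{n\ge1}$ be a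 sequence of positive integers with $K_n\to\infty$. Suppose that $\mathrm{Prob}\{n:\mathrm{LB}_s(K_n)=b\}$ exists for all $s\ge2$ and $b\in\mathcal F_s$, and that $$L(\mu)=\lim_{s\to\infty}\mathrm{Prob}\{n\in\mathbb N:\mathrm{LB}_s(K_n)\le\mu|s\}$$ exists for every $\mu\in\mathcal F^*$ with $\mu(1)=1$. Each $\beta\in(0,1)$ equals $\phi\left(\sum_{k\ge1}\mu(k)\omega^{k-1}-1\right)$ for exactly one $\mu\in\mathcal F^*$ with $\mu(1)=1$; define $f_K^*:[0,1]\to[0,1]$ by $f_K^*(0)=0$, $f_K^*(1)=1$ and $f_K^*(\beta)=L(\mu)$ for this $\mu$. Suppose that $f_K^*$ is continuous and strictly increasing (that is, $K$ has continuous leading block distribution under Zeckendorf expansion). A continuous function $f:[1,\infty)\to\mathbb R$ is a uniform continuation of $F$ if $f(n)=F_n$ for all $n\in\mathbb N$ and the functions $$f_n:[0,1]\to[0,1],\qquad f_n(p)=\frac{f(n+p)-f(n)}{f(n+1)-f(n)},$$ converge uniformly as $n\to\infty$ to a continuous, strictly increasing function, denoted by $f_\infty$. Then there is a uniform continuation $f$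 of $F$, which is a strictly increasing bijection of $[1,\infty)$ onto $[1,\infty)$, such that $f_\infty:[0,1]\to[0,1]$ is a bijection with $f_\infty^{-1}=f_K^*$, and such that $\{f^{-1}(K_n)\}$ (fractional parts) is equidistributed, i.e. $\mathrm{Prob}\{n\in\mathbb N:\{f^{-1}(K_n)\}\le\beta\}=\beta$ for all $\beta\in[0,1]$. -/

import Mathlib

open Filter Topology Set

namespace ZeckendorfBlocks

/-! Sequences `x_1, x_2, …` are functions `ℕ → _` whose value at `0` is never used.
Entries of tuples and of digit strings are numbered from `0`: entry `k` here is the `(k + 1)`-st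
entry in the usual numbering. -/

/-- The shifted Fibonacci sequence, `F 1 = 1`, `F 2 = 2`, `F (n + 2) = F (n + 1) + F n`. -/
def F (n : ℕ) : ℕ := Nat.fib (n + 1)

/-- Coefficient functions of Zeckendorf expansions: nonempty finite tuples of digits `0`, `1` with
first entry `1` and no two consecutive entries equal to `1`. -/
def IsZeckTuple (ε : List ℕ) : Prop :=
  ε.head? = some 1 ∧ (∀ a ∈ ε, a ≤ 1) ∧ ε.IsChain (fun a b => a * b = 0)

/-- `ε * F = ε(1) F_t + ε(2) F_{t-1} + ⋯ + ε(t) F_1`, where `t` is the length of `ε`. -/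
def star (ε : List ℕ) : ℕ := ∑ k ∈ Finset.range ε.length, ε.getD k 0 * F (ε.length - k)

/-- `ε · (1, ω, ω², …)`, where `ω = φ⁻¹` and `φ` is the golden ratio. -/
noncomputable def dot (ε : List ℕ) : ℝ :=
  ∑ k ∈ Finset.range ε.length, (ε.getD k 0 : ℝ) * (Real.goldenRatio⁻¹) ^ k

/-- `LB_s(n) = b`: the Zeckendorf expansion of `n` has at least `s` digits, and its first `s`
digits form the tuple `b`. -/
def IsLeadingBlock (s n : ℕ) (b : List ℕ) : Prop :=
  ∃ ε : List ℕ, IsZeckTuple ε ∧ n = star ε ∧ s ≤ ε.length ∧ b = ε.take s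

/-- The order on blocks of equal length given by comparing their values under `dot`. -/
def BlockLE (b c : List ℕ) : Prop := b = c ∨ dot b < dot c

open Classical in
/-- `Prob {n ∈ ℕ : P n} = p`, that is, the limit defining the natural density exists and is `p`. -/
def HasProb (P : ℕ → Prop) (p : ℝ) : Prop :=
  Tendsto (fun n : ℕ => (((Finset.Icc 1 n).filter P).card : ℝ) / (n : ℝ)) atTop (𝓝 p)

/-- `K` is a sequence of positive integers approaching infinity, and `Prob {n : LB_s(K_n) = b}`
exists for every `s ≥ 2` and every leading block `b` of length `s`. -/
def HasStrongDistribution (K : ℕ → ℕ) : Prop :=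
  (∀ n, 1 ≤ n → 0 < K n) ∧ Tendsto K atTop atTop ∧
    ∀ s, 2 ≤ s → ∀ b : List ℕ, IsZeckTuple b → b.length = s →
      ∃ p : ℝ, HasProb (fun n => IsLeadingBlock s (K n) b) p

/-- Zeckendorf expressions for the unit interval: infinite strings of digits `0`, `1` without
consecutive `1`s and without a tail `1, 0, 1, 0, …`. -/
def IsZeckString (μ : ℕ → ℕ) : Prop :=
  (∀ k, μ k ≤ 1) ∧ (∀ k, μ k * μ (k + 1) = 0) ∧
    ∀ j, (fun n => μ (j + n)) ≠ fun n => if Even n then 1 else 0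

/-- The truncation `μ|s`. -/
def trunc (μ : ℕ → ℕ) (s : ℕ) : List ℕ := (List.range s).map μ

/-- `φ (μ · (1, ω, ω², …) - 1)`. -/
noncomputable def unitValue (μ : ℕ → ℕ) : ℝ :=
  Real.goldenRatio * ((∑' k, (μ k : ℝ) * (Real.goldenRatio⁻¹) ^ k) - 1)

/-- `lim_{s → ∞} Prob {n : LB_s(K_n) ≤ μ|s} = l`; all the probabilities and the limit are
required to exist. -/
def IsCumulativeValue (K : ℕ → ℕ) (μ : ℕ → ℕ) (l : ℝ) : Prop :=
  ∃ p : ℕ → ℝ,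
    (∀ s, 2 ≤ s →
      HasProb (fun n => ∃ b, IsLeadingBlock s (K n) b ∧ BlockLE b (trunc μ s)) (p s)) ∧
    Tendsto p atTop (𝓝 l)

open Classical in
/-- The function `f_K^*` (only its values on `[0, 1]` matter): `0` at `0`, `1` at `1`, and at a
point `φ (μ · (1, ω, ω², …) - 1)` of `(0, 1)`, where `μ` is a Zeckendorf expression with first
digit `1`, the value `lim_{s → ∞} Prob {n : LB_s(K_n) ≤ μ|s}`. Every point of `(0, 1)` comes
from exactly one `μ`. -/
noncomputable def fStar (K : ℕ → ℕ) (β : ℝ) : ℝ :=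
  if β ≤ 0 then 0
  else if 1 ≤ β then 1
  else Classical.epsilon fun l : ℝ =>
    ∃ μ : ℕ → ℕ, IsZeckString μ ∧ μ 0 = 1 ∧ unitValue μ = β ∧ IsCumulativeValue K μ l

/-- `K` has continuous leading block distribution under Zeckendorf expansion. -/
def HasContinuousDistribution (K : ℕ → ℕ) : Prop :=
  HasStrongDistribution K ∧
    (∀ μ : ℕ → ℕ, IsZeckString μ → μ 0 = 1 → ∃ l : ℝ, IsCumulativeValue K μ l) ∧
    ContinuousOn (fStar K) (Icc 0 1) ∧ StrictMonoOn (fStar K) (Icc 0 1)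

/-- `h_n(p) = (h(n + p) - h(n)) / (h(n + 1) - h(n))`. -/
noncomputable def increment (h : ℝ → ℝ) (n : ℕ) (p : ℝ) : ℝ :=
  (h (n + p) - h n) / (h (n + 1) - h n)

/-- `h`, restricted to `[1, ∞)`, is a uniform continuation of the increasing sequence `H`. -/
def IsUniformContinuation (H : ℕ → ℕ) (h : ℝ → ℝ) : Prop :=
  ContinuousOn h (Ici 1) ∧ (∀ n : ℕ, 1 ≤ n → h n = H n) ∧
    (∀ n : ℕ, 1 ≤ n → MapsTo (increment h n) (Icc 0 1) (Icc 0 1)) ∧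
    ∃ g : ℝ → ℝ, TendstoUniformlyOn (increment h) g atTop (Icc 0 1) ∧
      ContinuousOn g (Icc 0 1) ∧ StrictMonoOn g (Icc 0 1)

/-- `h_∞(p) = lim_{n → ∞} h_n(p)`. -/
noncomputable def limitIncrement (h : ℝ → ℝ) (p : ℝ) : ℝ :=
  limUnder atTop fun n : ℕ => increment h n p

/-- The fractional parts of `x_1, x_2, …` are equidistributed. -/
def FractEquidistributed (x : ℕ → ℝ) : Prop :=
  ∀ β ∈ Icc (0 : ℝ) 1, HasProb (fun n => Int.fract (x n) ≤ β) β

end ZeckendorfBlocks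

namespace ZeckendorfBlocks

open Real

/-! For `F t ≤ m < F (t + 1)` let x = (m - F t) / F (t - 1) be the relative position of m. By
Binet's formula, x differs from φ(dot b - 1), where b is the leading block of length s, by O(ω^s) +
O(1 / F (t - 1)) (`IsLeadingBlock.abs_position_sub_le`). Comparing blocks is thus nearly the same as
comparing positions, and squeezing between nearby values of the continuous, strictly increasing
f_K^* shows that the position of K_n is at most y with density f_K^*(y)
(`HasContinuousDistribution.hasProb_fStar_le`).

Let h be the inverse of f_K^* on [0, 1], and let f(n + p) = F n + h(p) F (n - 1). All increments of
f equal h, so f is a uniform continuation with f_∞ = h. The fractional part of f⁻¹(m) is f_K^*(x)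
(`fract_invFunOn_continuation`). Applying a continuous distribution function to its own variable
gives the uniform distribution, which is the equidistribution claimed. -/

/-! ### Fibonacci numbers and bounds for the golden ratio -/

lemma F_add_two (n : ℕ) : F (n + 2) = F n + F (n + 1) := Nat.fib_add_two

lemma F_pos (n : ℕ) : 0 < F n := Nat.fib_pos.2 n.succ_pos

lemma F_mono : Monotone F := fun _ _ h => Nat.fib_mono (Nat.succ_le_succ h)

/-- The case n = 1 relies on the extra value `F 0 = 1`. -/
lemma F_succ_eq {n : ℕ} (hn : 1 ≤ n) : F (n + 1) = F n + F (n - 1) := by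
  obtain ⟨k, rfl⟩ := Nat.exists_eq_add_of_le' hn
  rw [Nat.add_sub_cancel, F_add_two, add_comm]

lemma tendsto_F : Tendsto F atTop atTop := by
  refine tendsto_atTop_mono' _ ?_ tendsto_id
  filter_upwards [eventually_ge_atTop 5] with n hn
  exact (Nat.le_fib_self hn).trans (Nat.fib_mono n.le_succ)

lemma exists_F_le_lt {m : ℕ} (hm : 1 ≤ m) : ∃ t, 1 ≤ t ∧ F t ≤ m ∧ m < F (t + 1) := by
  have h2 : 2 ≤ m.greatestFib := by
    rw [Nat.le_greatestFib]; simpa using hm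
  obtain ⟨t, ht⟩ := Nat.exists_eq_add_of_le' h2
  refine ⟨t + 1, by omega, ?_, ?_⟩
  · have := Nat.fib_greatestFib_le m
    rwa [ht] at this
  · have := Nat.lt_fib_greatestFib_add_one m
    rwa [ht] at this

lemma F_block_unique {m t u : ℕ} (h1 : F t ≤ m) (h2 : m < F (t + 1)) (h3 : F u ≤ m)
    (h4 : m < F (u + 1)) : t = u := by
  rcases lt_trichotomy t u with h | h | h
  · have := F_mono (show t + 1 ≤ u from h); omega
  · exact h
  · have := F_mono (show u + 1 ≤ t from h); omega

lemma inv_goldenRatio_pos : 0 < goldenRatio⁻¹ := inv_pos.2 goldenRatio_pos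

lemma inv_goldenRatio_eq : goldenRatio⁻¹ = goldenRatio - 1 := by
  linarith [inv_goldenRatio, goldenRatio_add_goldenConj]

lemma goldenRatio_lt_five_thirds : goldenRatio < 5 / 3 := by
  by_contra h
  push Not at h
  nlinarith [goldenRatio_sq]

lemma inv_goldenRatio_lt : goldenRatio⁻¹ < 2 / 3 := by
  rw [inv_goldenRatio_eq]; linarith [goldenRatio_lt_five_thirds]

/-! ### Digit lists -/

lemma star_cons (a : ℕ) (l : List ℕ) : star (a :: l) = a * F (l.length + 1) + star l := by
  unfold star
  rw [List.length_cons, Finset.sum_range_succ', add_comm]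
  simp

lemma dot_cons (a : ℕ) (l : List ℕ) : dot (a :: l) = a + goldenRatio⁻¹ * dot l := by
  unfold dot
  rw [List.length_cons, Finset.sum_range_succ', add_comm, Finset.mul_sum]
  simp only [List.getD_cons_zero, pow_zero, mul_one, List.getD_cons_succ, pow_succ]
  congr 1
  exact Finset.sum_congr rfl fun _ _ => by ring

@[simp] lemma star_nil : star [] = 0 := by simp [star]

@[simp] lemma dot_nil : dot [] = 0 := by simp [dot]

lemma dot_nonneg (l : List ℕ) : 0 ≤ dot l :=
  Finset.sum_nonneg fun _ _ => mul_nonneg (Nat.cast_nonneg _)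
    (pow_nonneg inv_goldenRatio_pos.le _)

/-- Since ω < 2/3 and 1 + (2/3) · 3 = 3, the bound reproduces itself when a digit is prepended. -/
lemma dot_le_three {l : List ℕ} (h : ∀ a ∈ l, a ≤ 1) : dot l ≤ 3 := by
  induction l with
  | nil => simp
  | cons a l ih =>
    rw [dot_cons]
    have h1 : (a : ℝ) ≤ 1 := by exact_mod_cast h a (by simp)
    have h2 := ih fun b hb => h b (by simp [hb])
    nlinarith [inv_goldenRatio_pos, inv_goldenRatio_lt, dot_nonneg l]

lemma abs_dot_sub_dot_take_le {l : List ℕ} (h : ∀ a ∈ l, a ≤ 1) (s : ℕ) :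
    |dot l - dot (l.take s)| ≤ 3 * goldenRatio⁻¹ ^ s := by
  induction l generalizing s with
  | nil => simpa using pow_nonneg inv_goldenRatio_pos.le s
  | cons a l ih =>
    cases s with
    | zero => simpa [abs_of_nonneg (dot_nonneg _)] using dot_le_three h
    | succ s =>
      rw [List.take_succ_cons, dot_cons, dot_cons]
      have h2 := ih (fun b hb => h b (by simp [hb])) s
      calc _ = goldenRatio⁻¹ * |dot l - dot (l.take s)| := by
              rw [← abs_of_pos inv_goldenRatio_pos, ← abs_mul, abs_of_pos inv_goldenRatio_pos]
              congr 1; ring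
        _ ≤ goldenRatio⁻¹ * (3 * goldenRatio⁻¹ ^ s) := by
              gcongr
        _ = _ := by ring

/-- The limit of `F n / φ ^ n`. -/
noncomputable def growthConst : ℝ := goldenRatio / √5

/-- By Binet's formula the error is ψ^(n+1) / √5 in absolute value, where the conjugate ψ equals -ω.
-/
lemma abs_F_sub_le (n : ℕ) :
    |(F n : ℝ) - growthConst * goldenRatio ^ n| ≤ goldenRatio⁻¹ ^ n := by
  have h5 : (1 : ℝ) ≤ √5 := by
    rw [show (1 : ℝ) = √1 by simp]; exact Real.sqrt_le_sqrt (by norm_num)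
  have hω : goldenConj = -goldenRatio⁻¹ := by rw [inv_goldenRatio]; ring
  have h : (F n : ℝ) - growthConst * goldenRatio ^ n = -(goldenConj ^ (n + 1) / √5) := by
    unfold F growthConst
    rw [coe_fib_eq, pow_succ]
    field_simp
    ring
  rw [h, hω, abs_neg, abs_div, abs_pow, abs_neg, abs_of_pos inv_goldenRatio_pos,
    abs_of_pos (by linarith), pow_succ]
  rw [div_le_iff₀ (by linarith)]
  have := pow_pos inv_goldenRatio_pos n
  have h1 := inv_goldenRatio_lt
  gcongr
  linarith

/-- Replacing each Fibonacci number by its main term costs a geometric series of powers of ω, so the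
error is bounded independently of the length. The factor 1 - ω^length closes the induction: ω^(n+1)
≤ 2(ω^n - ω^(n+1)) because 3ω < 2. -/
lemma abs_star_sub_le {l : List ℕ} (h : ∀ a ∈ l, a ≤ 1) :
    |(star l : ℝ) - growthConst * goldenRatio ^ l.length * dot l| ≤
      2 * (1 - goldenRatio⁻¹ ^ l.length) := by
  induction l with
  | nil => simp
  | cons a l ih =>
    have h2 := ih fun b hb => h b (by simp [hb])
    have h1 : (a : ℝ) ≤ 1 := by exact_mod_cast h a (by simp)
    have h0 : (0 : ℝ) ≤ a := a.cast_nonneg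
    rw [star_cons, dot_cons, List.length_cons]
    have hφ := goldenRatio_ne_zero
    have e : ((a * F (l.length + 1) + star l : ℕ) : ℝ) -
        growthConst * goldenRatio ^ (l.length + 1) * (a + goldenRatio⁻¹ * dot l) =
        a * ((F (l.length + 1) : ℝ) - growthConst * goldenRatio ^ (l.length + 1)) +
        ((star l : ℝ) - growthConst * goldenRatio ^ l.length * dot l) := by
      push_cast
      rw [pow_succ]
      field_simp
      ring
    rw [e]
    refine (abs_add_le _ _).trans ?_
    rw [abs_mul, abs_of_nonneg h0]
    have h3 := abs_F_sub_le (l.length + 1)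
    have h4 : (a : ℝ) * |(F (l.length + 1) : ℝ) - growthConst * goldenRatio ^ (l.length + 1)| ≤
        goldenRatio⁻¹ ^ (l.length + 1) :=
      (mul_le_of_le_one_left (abs_nonneg _) h1).trans h3
    have h5 := pow_pos inv_goldenRatio_pos l.length
    rw [pow_succ goldenRatio⁻¹] at h4 ⊢
    nlinarith [inv_goldenRatio_lt]

lemma star_lt_F {l : List ℕ} (h : ∀ a ∈ l, a ≤ 1) (hc : l.IsChain fun a b => a * b = 0) :
    star l < F (l.length + 1) := by
  -- The bound with one more digit is carried along: a leading 1 is followed by 0, so what is needed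
  -- is the bound for the list two digits shorter.
  suffices H : star l < F (l.length + 1) ∧ ∀ a, a ≤ 1 → (a :: l).IsChain (fun a b => a * b = 0) →
      star (a :: l) < F (l.length + 2) from H.1
  induction l with
  | nil =>
    refine ⟨by simpa using F_pos 1, fun a ha _ => ?_⟩
    rw [star_cons]
    simp [F, Nat.fib_add_two]
    omega
  | cons b l ih =>
    have hl := ih (fun c hc => h c (by simp [hc])) hc.tail
    have hb : b ≤ 1 := h b (by simp)
    refine ⟨hl.2 b hb hc, fun a ha hac => ?_⟩
    have h1 : star (b :: l) < F (l.length + 1 + 1) := hl.2 b hb hc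
    rw [star_cons, List.length_cons]
    rw [F_add_two (l.length + 1)]
    obtain rfl | rfl : a = 0 ∨ a = 1 := by omega
    · simp only [zero_mul, zero_add]; omega
    · have hb0 : b = 0 := by simpa using (List.isChain_cons_cons.1 hac).1
      subst hb0
      have := hl.1
      rw [star_cons]
      simp only [one_mul, zero_mul, zero_add]
      omega

lemma IsZeckTuple.F_length_le_star {l : List ℕ} (h : IsZeckTuple l) : F l.length ≤ star l := by
  obtain ⟨h, -⟩ := h
  cases l with
  | nil => simp at h
  | cons a l =>
    simp at h
    subst h
    rw [star_cons]; simp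

/-- Greedy expansion. Leading zeros are allowed so that the length is exactly t; once a digit 1 is
taken, the remainder is small enough for the next digit to be 0. -/
lemma exists_digits (t : ℕ) : ∀ m < F (t + 1), ∃ l : List ℕ, l.length = t ∧ (∀ a ∈ l, a ≤ 1) ∧
    l.IsChain (fun a b => a * b = 0) ∧ star l = m := by
  have cons_zero : ∀ l : List ℕ, l.IsChain (fun a b => a * b = 0) →
      (0 :: l).IsChain (fun a b => a * b = 0) := by
    intro l hl
    cases l <;> simp_all
  induction t using Nat.twoStepInduction with
  | zero =>
    intro m hm
    refine ⟨[], rfl, by simp, by simp, ?_⟩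
    simp [F] at hm ⊢; omega
  | one =>
    intro m hm
    have hm' : m ≤ 1 := by simp [F, Nat.fib_add_two] at hm; omega
    refine ⟨[m], rfl, by simpa using hm', by simp, ?_⟩
    rw [star_cons]; simp [F]
  | more t ih1 ih2 =>
    intro m hm
    rcases lt_or_ge m (F (t + 2)) with h | h
    · obtain ⟨l, hl, hd, hc, hs⟩ := ih2 m h
      refine ⟨0 :: l, by simp [hl], by simpa using hd, cons_zero l hc, ?_⟩
      rw [star_cons]; simpa using hs
    · have : m - F (t + 2) < F (t + 1) := by
        have := F_add_two (t + 1)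
        rw [show t + 1 + 2 = t + 2 + 1 by ring] at this
        rw [show t + 1 + 1 = t + 2 by ring] at this
        omega
      obtain ⟨l, hl, hd, hc, hs⟩ := ih1 _ this
      refine ⟨1 :: 0 :: l, by simp [hl], by simpa using hd, ?_, ?_⟩
      · exact List.isChain_cons_cons.2 ⟨by simp, cons_zero l hc⟩
      · rw [star_cons, star_cons, List.length_cons, hl, hs, one_mul, zero_mul, zero_add]
        exact Nat.add_sub_cancel' h

lemma exists_isZeckTuple {t m : ℕ} (ht : 1 ≤ t) (h1 : F t ≤ m) (h2 : m < F (t + 1)) :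
    ∃ l : List ℕ, l.length = t ∧ IsZeckTuple l ∧ star l = m := by
  obtain ⟨l, hl, hd, hc, hs⟩ := exists_digits t m h2
  refine ⟨l, hl, ⟨?_, hd, hc⟩, hs⟩
  cases l with
  | nil => simp at hl; omega
  | cons a l =>
    have ha : a ≤ 1 := hd a (by simp)
    have : a ≠ 0 := by
      rintro rfl
      have h3 := star_lt_F (l := l) (fun c hc => hd c (List.mem_cons_of_mem _ hc)) hc.tail
      rw [star_cons] at hs
      simp at hl
      rw [hl] at h3
      simp at hs
      omega
    simp; omega

lemma exists_isLeadingBlock {s t m : ℕ} (ht : 1 ≤ t) (h1 : F t ≤ m) (h2 : m < F (t + 1))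
    (hs : s ≤ t) : ∃ b, IsLeadingBlock s m b := by
  obtain ⟨l, hl, hz, hm⟩ := exists_isZeckTuple ht h1 h2
  exact ⟨_, l, hz, hm.symm, hl ▸ hs, rfl⟩

/-- The relative position of `m` between `F t` and `F (t + 1)` is approximated by the value of
its leading block. -/
lemma IsLeadingBlock.abs_position_sub_le {s t m : ℕ} {b : List ℕ} (hb : IsLeadingBlock s m b)
    (ht : 1 ≤ t) (h1 : F t ≤ m) (h2 : m < F (t + 1)) :
    |((m : ℝ) - F t) / F (t - 1) - goldenRatio * (dot b - 1)| ≤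
      5 * goldenRatio⁻¹ ^ s + 8 / F (t - 1) := by
  obtain ⟨l, hz, hm, -, rfl⟩ := hb
  have hlt : l.length = t := by
    subst hm
    exact F_block_unique hz.F_length_le_star (star_lt_F hz.2.1 hz.2.2) h1 h2
  obtain ⟨u, rfl⟩ := Nat.exists_eq_add_of_le' ht
  have hF : (0 : ℝ) < F u := by exact_mod_cast F_pos u
  have e1 := abs_star_sub_le hz.2.1
  rw [← hm, hlt] at e1
  have e2 := abs_F_sub_le (u + 1)
  have e3 := abs_F_sub_le u
  have hω1 : goldenRatio⁻¹ ≤ 1 := by linarith [inv_goldenRatio_lt]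
  have p1 := pow_le_one₀ inv_goldenRatio_pos.le hω1 (n := u)
  have p2 := pow_pos inv_goldenRatio_pos (u + 1)
  have p2' := pow_le_one₀ inv_goldenRatio_pos.le hω1 (n := u + 1)
  have hd3 := dot_le_three hz.2.1
  have hd0 := dot_nonneg l
  have hφ := goldenRatio_pos
  have hφ2 := goldenRatio_lt_five_thirds
  have e4 : |((m : ℝ) - F (u + 1)) / F u - goldenRatio * (dot l - 1)| ≤ 8 / F u := by
    rw [div_sub' hF.ne', abs_div, abs_of_pos hF]
    gcongr
    -- The main terms cancel exactly; the three errors are at most 2, 1 and 4.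
    have : (m : ℝ) - F (u + 1) - F u * (goldenRatio * (dot l - 1)) =
        (m - growthConst * goldenRatio ^ (u + 1) * dot l) -
        (F (u + 1) - growthConst * goldenRatio ^ (u + 1)) -
        (goldenRatio * (dot l - 1)) * (F u - growthConst * goldenRatio ^ u) := by ring
    rw [this]
    have hA : |goldenRatio * (dot l - 1)| ≤ 4 := by
      rw [abs_mul, abs_of_pos hφ]
      have : |dot l - 1| ≤ 2 := by rw [abs_le]; constructor <;> linarith
      nlinarith
    have hB : |(goldenRatio * (dot l - 1)) * (F u - growthConst * goldenRatio ^ u)| ≤ 4 * 1 := by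
      rw [abs_mul]
      exact mul_le_mul hA (e3.trans p1) (abs_nonneg _) (by norm_num)
    refine (abs_sub _ _).trans ?_
    have := abs_sub (m - growthConst * goldenRatio ^ (u + 1) * dot l)
      (F (u + 1) - growthConst * goldenRatio ^ (u + 1))
    linarith
  have e5 : |goldenRatio * (dot l - 1) - goldenRatio * (dot (l.take s) - 1)| ≤
      5 * goldenRatio⁻¹ ^ s := by
    rw [← mul_sub, abs_mul, abs_of_pos hφ, sub_sub_sub_cancel_right]
    have := abs_dot_sub_dot_take_le hz.2.1 s
    have := pow_pos inv_goldenRatio_pos s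
    nlinarith [abs_nonneg (dot l - dot (l.take s))]
  simp only [Nat.add_sub_cancel]
  have := abs_sub_le (((m : ℝ) - F (u + 1)) / F u) (goldenRatio * (dot l - 1))
    (goldenRatio * (dot (l.take s) - 1))
  linarith

/-! ### Infinite expansions -/

lemma dot_trunc (μ : ℕ → ℕ) (s : ℕ) :
    dot (trunc μ s) = ∑ k ∈ Finset.range s, (μ k : ℝ) * goldenRatio⁻¹ ^ k := by
  unfold dot trunc
  simp only [List.length_map, List.length_range]
  refine Finset.sum_congr rfl fun k hk => ?_
  have := Finset.mem_range.1 hk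
  simp [List.getD, this]

lemma abs_unitValue_sub_le {μ : ℕ → ℕ} (hμ : ∀ k, μ k ≤ 1) (s : ℕ) :
    |unitValue μ - goldenRatio * (dot (trunc μ s) - 1)| ≤ 5 * goldenRatio⁻¹ ^ s := by
  have hω1 : goldenRatio⁻¹ < 1 := by linarith [inv_goldenRatio_lt]
  have hg := summable_geometric_of_lt_one inv_goldenRatio_pos.le hω1
  have hμ1 : ∀ k, (μ k : ℝ) ≤ 1 := fun k => by exact_mod_cast hμ k
  have hle : ∀ k, (μ k : ℝ) * goldenRatio⁻¹ ^ k ≤ goldenRatio⁻¹ ^ k := fun k =>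
    mul_le_of_le_one_left (pow_nonneg inv_goldenRatio_pos.le _) (hμ1 k)
  have h0 : ∀ k, 0 ≤ (μ k : ℝ) * goldenRatio⁻¹ ^ k := fun k =>
    mul_nonneg (Nat.cast_nonneg _) (pow_nonneg inv_goldenRatio_pos.le _)
  have hs : Summable fun k => (μ k : ℝ) * goldenRatio⁻¹ ^ k := Summable.of_nonneg_of_le h0 hle hg
  have hsplit := hs.sum_add_tsum_nat_add s
  have ht : ∑' k, (μ (k + s) : ℝ) * goldenRatio⁻¹ ^ (k + s) ≤ 3 * goldenRatio⁻¹ ^ s := by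
    have h1 := ((summable_nat_add_iff s).2 hs).tsum_le_tsum (fun k => hle (k + s))
      ((summable_nat_add_iff s).2 hg)
    refine h1.trans ?_
    simp only [pow_add]
    rw [tsum_mul_right, tsum_geometric_of_lt_one inv_goldenRatio_pos.le hω1]
    have := inv_goldenRatio_lt
    have hp := pow_pos inv_goldenRatio_pos s
    gcongr
    rw [inv_le_comm₀ (by linarith) (by norm_num)]
    linarith
  have ht0 : 0 ≤ ∑' k, (μ (k + s) : ℝ) * goldenRatio⁻¹ ^ (k + s) := tsum_nonneg fun k => h0 _
  unfold unitValue
  rw [dot_trunc, ← hsplit, ← mul_sub, abs_mul, abs_of_pos goldenRatio_pos, sub_sub_sub_cancel_right,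
    add_sub_cancel_left, abs_of_nonneg ht0]
  have hφ2 := goldenRatio_lt_five_thirds
  have hφ := goldenRatio_pos
  nlinarith

/-- The orbit of `y` under the transformation `x ↦ φ x - ⌊φ x⌋`. -/
noncomputable def betaOrbit (y : ℝ) : ℕ → ℝ
  | 0 => y
  | n + 1 => Int.fract (goldenRatio * betaOrbit y n)

/-- The greedy digits of `y` in base `φ`. -/
noncomputable def betaDigit (y : ℝ) (n : ℕ) : ℕ := ⌊goldenRatio * betaOrbit y n⌋₊

lemma betaOrbit_mem {y : ℝ} (hy : y ∈ Ico (0 : ℝ) 1) (n : ℕ) : betaOrbit y n ∈ Ico (0 : ℝ) 1 := by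
  cases n with
  | zero => exact hy
  | succ n => exact ⟨Int.fract_nonneg _, Int.fract_lt_one _⟩

lemma betaOrbit_succ {y : ℝ} (hy : y ∈ Ico (0 : ℝ) 1) (n : ℕ) :
    betaOrbit y (n + 1) = goldenRatio * betaOrbit y n - betaDigit y n := by
  have h := mul_nonneg goldenRatio_pos.le (betaOrbit_mem hy n).1
  rw [betaDigit, natCast_floor_eq_intCast_floor h]
  rfl

lemma betaDigit_le_one {y : ℝ} (hy : y ∈ Ico (0 : ℝ) 1) (n : ℕ) : betaDigit y n ≤ 1 := by
  have h := betaOrbit_mem hy n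
  have : goldenRatio * betaOrbit y n < 2 := by
    nlinarith [h.1, h.2, goldenRatio_pos, goldenRatio_lt_two]
  have := (Nat.floor_lt (mul_nonneg goldenRatio_pos.le h.1) (n := 2)).2 (by exact_mod_cast this)
  unfold betaDigit
  omega

/-- A digit 1 leaves a remainder below φ - 1 = ω, and φ times that is below 1. -/
lemma betaDigit_mul_succ {y : ℝ} (hy : y ∈ Ico (0 : ℝ) 1) (n : ℕ) :
    betaDigit y n * betaDigit y (n + 1) = 0 := by
  rcases Nat.le_one_iff_eq_zero_or_eq_one.1 (betaDigit_le_one hy n) with h | h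
  · simp [h]
  · have h1 := betaOrbit_succ hy n
    rw [h] at h1
    have h2 := betaOrbit_mem hy n
    have h3 : goldenRatio * betaOrbit y (n + 1) < 1 := by
      rw [h1]
      push_cast
      nlinarith [h2.1, h2.2, goldenRatio_pos, goldenRatio_sq, one_lt_goldenRatio]
    have : betaDigit y (n + 1) = 0 := Nat.floor_eq_zero.2 h3
    simp [this]

/-- Along a tail 1, 0, 1, 0, … the distance of the orbit from 1 is multiplied by φ² every two steps,
yet it never exceeds 1. -/
lemma betaDigit_tail_ne {y : ℝ} (hy : y ∈ Ico (0 : ℝ) 1) (j : ℕ) :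
    (fun n => betaDigit y (j + n)) ≠ fun n => if Even n then 1 else 0 := by
  intro h
  have h' : ∀ n, betaDigit y (j + n) = if Even n then 1 else 0 := fun n => congrFun h n
  have key : ∀ n, 1 - betaOrbit y (j + 2 * n) =
      (goldenRatio ^ 2) ^ n * (1 - betaOrbit y j) := by
    intro n
    induction n with
    | zero => simp
    | succ n ih =>
      have h1 := betaOrbit_succ hy (j + 2 * n)
      have h2 := betaOrbit_succ hy (j + 2 * n + 1)
      rw [h' (2 * n), if_pos (by simp)] at h1
      rw [add_assoc j (2 * n) 1, h' (2 * n + 1), if_neg (by simp)] at h2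
      rw [show j + 2 * (n + 1) = j + (2 * n + 1) + 1 by ring, h2, ← add_assoc, h1, pow_succ,
        mul_right_comm, ← ih]
      push_cast
      linear_combination (-1 : ℝ) * goldenRatio_sq
  have hpos : 0 < 1 - betaOrbit y j := by linarith [(betaOrbit_mem hy j).2]
  have h1 : 1 < goldenRatio ^ 2 := by nlinarith [one_lt_goldenRatio]
  obtain ⟨n, hn⟩ := pow_unbounded_of_one_lt (1 / (1 - betaOrbit y j)) h1
  rw [div_lt_iff₀ hpos, ← key] at hn
  linarith [(betaOrbit_mem hy (j + 2 * n)).1]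

/-- The Zeckendorf expression with first digit `1` of a point of the unit interval. -/
noncomputable def unitDigits (y : ℝ) : ℕ → ℕ
  | 0 => 1
  | 1 => 0
  | n + 2 => betaDigit y n

lemma isZeckString_unitDigits {y : ℝ} (hy : y ∈ Ico (0 : ℝ) 1) : IsZeckString (unitDigits y) := by
  refine ⟨?_, ?_, ?_⟩
  · rintro (_ | _ | k)
    · simp [unitDigits]
    · simp [unitDigits]
    · exact betaDigit_le_one hy k
  · rintro (_ | _ | k)
    · simp [unitDigits]
    · simp [unitDigits]
    · exact betaDigit_mul_succ hy k
  · intro j h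
    refine betaDigit_tail_ne hy j (funext fun n => ?_)
    -- The shift skips the two prefixed digits and, being even, preserves the pattern.
    have := congrFun h (n + 2)
    simpa [unitDigits, ← add_assoc, Nat.even_add] using this

lemma betaOrbit_eq_sum {y : ℝ} (hy : y ∈ Ico (0 : ℝ) 1) (n : ℕ) :
    ∑ k ∈ Finset.range n, (betaDigit y k : ℝ) * goldenRatio⁻¹ ^ (k + 1) =
      y - goldenRatio⁻¹ ^ n * betaOrbit y n := by
  induction n with
  | zero => simp [betaOrbit]
  | succ n ih =>
    have := goldenRatio_ne_zero
    rw [Finset.sum_range_succ, ih, betaOrbit_succ hy, pow_succ]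
    field_simp
    ring

lemma tendsto_inv_goldenRatio_pow : Tendsto (fun n : ℕ => goldenRatio⁻¹ ^ n) atTop (𝓝 0) :=
  tendsto_pow_atTop_nhds_zero_of_lt_one inv_goldenRatio_pos.le (by linarith [inv_goldenRatio_lt])

/-- Subtracting the leading 1 and multiplying by φ moves greedy digit k from weight ω^(k+2) to
ω^(k+1), its weight in the expansion of y. -/
lemma unitValue_unitDigits {y : ℝ} (hy : y ∈ Ico (0 : ℝ) 1) : unitValue (unitDigits y) = y := by
  have h1 : Tendsto (fun n => 15 * goldenRatio⁻¹ ^ n) atTop (𝓝 0) := by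
    simpa using tendsto_inv_goldenRatio_pow.const_mul 15
  have h2 : ∀ n, |unitValue (unitDigits y) - y| ≤ 15 * goldenRatio⁻¹ ^ n := by
    intro n
    have e1 := abs_unitValue_sub_le (isZeckString_unitDigits hy).1 (n + 2)
    have e2 : goldenRatio * (dot (trunc (unitDigits y) (n + 2)) - 1) =
        y - goldenRatio⁻¹ ^ n * betaOrbit y n := by
      rw [dot_trunc, Finset.sum_range_succ', Finset.sum_range_succ', ← betaOrbit_eq_sum hy]
      simp only [unitDigits]
      simp only [Nat.cast_zero, zero_mul, add_zero, Nat.cast_one, pow_zero, mul_one,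
        add_sub_cancel_right, Finset.mul_sum]
      refine Finset.sum_congr rfl fun k _ => ?_
      have := goldenRatio_ne_zero
      rw [pow_succ _ (k + 1)]
      field_simp
    rw [e2, pow_add] at e1
    have hp := pow_pos inv_goldenRatio_pos n
    have hb := betaOrbit_mem hy n
    have h3 : goldenRatio⁻¹ ^ 2 ≤ 1 := pow_le_one₀ inv_goldenRatio_pos.le
      (by linarith [inv_goldenRatio_lt])
    rw [abs_le] at e1 ⊢
    constructor <;> nlinarith [hb.1, hb.2, mul_nonneg hp.le hb.1]
  have h3 : |unitValue (unitDigits y) - y| ≤ 0 := ge_of_tendsto' h1 h2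
  exact sub_eq_zero.1 (abs_nonpos_iff.1 h3)

end ZeckendorfBlocks

/-! ### Continuations of the Fibonacci sequence with prescribed increments -/

namespace ZeckendorfBlocks

/-- An order isomorphism between order-connected sets is a homeomorphism. -/
lemma continuousOn_of_strictMonoOn_bijOn {f : ℝ → ℝ} {s : Set ℝ} [s.OrdConnected]
    (hf : StrictMonoOn f s) (hb : BijOn f s s) : ContinuousOn f s := by
  have hs : (f '' s).OrdConnected := by rwa [hb.image_eq]
  rw [continuousOn_iff_continuous_domRestrict]
  exact continuous_subtype_val.comp (hf.orderIso f s).continuous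

/-- The continuation of `F` with all increments equal to `h`. -/
noncomputable def continuation (h : ℝ → ℝ) (x : ℝ) : ℝ :=
  F ⌊x⌋₊ + h (x - ⌊x⌋₊) * F (⌊x⌋₊ - 1)

section Continuation

variable {h : ℝ → ℝ}

lemma continuation_add {n : ℕ} {p : ℝ} (hp : p ∈ Ico (0 : ℝ) 1) :
    continuation h (n + p) = F n + h p * F (n - 1) := by
  have : ⌊(n : ℝ) + p⌋₊ = n := by
    rw [Nat.floor_eq_iff (by have := hp.1; positivity)]
    constructor <;> linarith [hp.1, hp.2]
  rw [continuation, this, add_sub_cancel_left]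

lemma exists_eq_natCast_add {x : ℝ} (hx : x ∈ Ici (1 : ℝ)) :
    ∃ n : ℕ, 1 ≤ n ∧ ∃ p ∈ Ico (0 : ℝ) 1, x = n + p := by
  have h0 : (0 : ℝ) ≤ x := zero_le_one.trans hx
  refine ⟨⌊x⌋₊, Nat.le_floor (by simpa using hx), x - ⌊x⌋₊, ⟨?_, ?_⟩, by ring⟩
  · linarith [Nat.floor_le h0]
  · linarith [Nat.lt_floor_add_one x]

lemma cast_F_succ {n : ℕ} (hn : 1 ≤ n) : (F (n + 1) : ℝ) = F n + F (n - 1) := by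
  exact_mod_cast F_succ_eq hn

lemma cast_F_pos (n : ℕ) : (0 : ℝ) < F n := by exact_mod_cast F_pos n

variable (hm : StrictMonoOn h (Icc 0 1)) (hb : BijOn h (Icc 0 1) (Icc 0 1))

include hm hb

lemma bijOn_strictMono_zero : h 0 = 0 := by
  obtain ⟨x, hx, hx0⟩ := hb.surjOn (left_mem_Icc.2 zero_le_one)
  have h1 := hm.monotoneOn (left_mem_Icc.2 zero_le_one) hx hx.1
  have h2 := (hb.mapsTo (left_mem_Icc.2 zero_le_one)).1
  linarith

lemma bijOn_strictMono_one : h 1 = 1 := by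
  obtain ⟨x, hx, hx0⟩ := hb.surjOn (right_mem_Icc.2 zero_le_one)
  have h1 := hm.monotoneOn hx (right_mem_Icc.2 zero_le_one) hx.2
  have h2 := (hb.mapsTo (right_mem_Icc.2 zero_le_one)).2
  linarith

lemma bijOn_strictMono_Ico {p : ℝ} (hp : p ∈ Ico (0 : ℝ) 1) : h p ∈ Ico (0 : ℝ) 1 :=
  ⟨(hb.mapsTo (Ico_subset_Icc_self hp)).1, by
    simpa [bijOn_strictMono_one hm hb] using
      hm (Ico_subset_Icc_self hp) (right_mem_Icc.2 zero_le_one) hp.2⟩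

lemma continuation_natCast (n : ℕ) : continuation h n = F n := by
  simpa [bijOn_strictMono_zero hm hb] using
    continuation_add (h := h) (n := n) (left_mem_Ico.2 zero_lt_one)

lemma continuation_mem_Ico {n : ℕ} (hn : 1 ≤ n) {p : ℝ} (hp : p ∈ Ico (0 : ℝ) 1) :
    continuation h (n + p) ∈ Ico (F n : ℝ) (F (n + 1)) := by
  have h1 := bijOn_strictMono_Ico hm hb hp
  have h2 := cast_F_pos (n - 1)
  rw [continuation_add hp, cast_F_succ hn]
  constructor
  · nlinarith [h1.1]
  · nlinarith [h1.2]

lemma strictMonoOn_continuation : StrictMonoOn (continuation h) (Ici 1) := by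
  intro x hx y hy hxy
  obtain ⟨n, hn, p, hp, rfl⟩ := exists_eq_natCast_add hx
  obtain ⟨m, hm', q, hq, rfl⟩ := exists_eq_natCast_add hy
  rcases lt_trichotomy n m with hnm | rfl | hnm
  · calc _ < (F (n + 1) : ℝ) := (continuation_mem_Ico hm hb hn hp).2
      _ ≤ F m := by exact_mod_cast F_mono hnm
      _ ≤ _ := (continuation_mem_Ico hm hb hm' hq).1
  · have hpq : p < q := by linarith
    rw [continuation_add hp, continuation_add hq]
    have := hm (Ico_subset_Icc_self hp) (Ico_subset_Icc_self hq) hpq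
    have := cast_F_pos (n - 1)
    gcongr
  · have : (m : ℝ) + 1 ≤ n := by exact_mod_cast hnm
    linarith [hp.1, hq.2]

lemma bijOn_continuation : BijOn (continuation h) (Ici 1) (Ici 1) := by
  refine ⟨fun x hx => ?_, (strictMonoOn_continuation hm hb).injOn, fun y hy => ?_⟩
  · obtain ⟨n, hn, p, hp, rfl⟩ := exists_eq_natCast_add hx
    have h1 : (1 : ℝ) ≤ F n := by exact_mod_cast F_pos n
    exact h1.trans (continuation_mem_Ico hm hb hn hp).1
  · have hy' : 1 ≤ ⌊y⌋₊ := Nat.le_floor (by simpa using hy)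
    have h0 : (0 : ℝ) ≤ y := zero_le_one.trans hy
    obtain ⟨t, ht, h1, h2⟩ := exists_F_le_lt hy'
    have h1' : (F t : ℝ) ≤ y := (Nat.le_floor_iff h0).1 h1
    have h2' : y < F (t + 1) := (Nat.floor_lt h0).1 h2
    have hF := cast_F_pos (t - 1)
    rw [cast_F_succ ht] at h2'
    have hq : (y - F t) / F (t - 1) ∈ Ico (0 : ℝ) 1 := by
      constructor
      · exact div_nonneg (by linarith) hF.le
      · rw [div_lt_one hF]; linarith
    obtain ⟨p, hp, hpq⟩ := hb.surjOn (Ico_subset_Icc_self hq)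
    have hp1 : p ∈ Ico (0 : ℝ) 1 := by
      refine ⟨hp.1, lt_of_le_of_ne hp.2 ?_⟩
      rintro rfl
      rw [bijOn_strictMono_one hm hb] at hpq
      exact hq.2.ne hpq.symm
    refine ⟨t + p, ?_, ?_⟩
    · have : (1 : ℝ) ≤ t := by exact_mod_cast ht
      simp only [mem_Ici]; linarith [hp.1]
    · rw [continuation_add hp1, hpq]; field_simp; ring

lemma increment_continuation {n : ℕ} (hn : 1 ≤ n) {p : ℝ} (hp : p ∈ Icc (0 : ℝ) 1) :
    increment (continuation h) n p = h p := by
  have hF := cast_F_pos (n - 1)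
  have e := cast_F_succ hn
  have e1 : continuation h ((n : ℝ) + 1) = F (n + 1) := by
    rw [← continuation_natCast hm hb]; push_cast; rfl
  have e2 : continuation h (n + p) = F n + h p * F (n - 1) := by
    -- At p = 1 the floor jumps to n + 1, and the formula persists because h(1) = 1.
    rcases hp.2.lt_or_eq with h1 | rfl
    · exact continuation_add ⟨hp.1, h1⟩
    · rw [e1, e, bijOn_strictMono_one hm hb, one_mul]
  rw [increment, e1, e2, continuation_natCast hm hb, e, add_sub_cancel_left, add_sub_cancel_left,
    mul_div_cancel_right₀ _ hF.ne']

lemma isUniformContinuation_continuation : IsUniformContinuation F (continuation h) := by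
  refine ⟨continuousOn_of_strictMonoOn_bijOn (strictMonoOn_continuation hm hb)
    (bijOn_continuation hm hb), fun n _ => continuation_natCast hm hb n, fun n hn p hp => ?_,
    h, ?_, continuousOn_of_strictMonoOn_bijOn hm hb, hm⟩
  · rw [increment_continuation hm hb hn hp]; exact hb.mapsTo hp
  · rw [Metric.tendstoUniformlyOn_iff]
    intro ε hε
    filter_upwards [eventually_ge_atTop 1] with n hn p hp
    rwa [increment_continuation hm hb hn hp, dist_self]

lemma limitIncrement_continuation {p : ℝ} (hp : p ∈ Icc (0 : ℝ) 1) :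
    limitIncrement (continuation h) p = h p := by
  refine Tendsto.limUnder_eq (tendsto_const_nhds.congr' ?_)
  filter_upwards [eventually_ge_atTop 1] with n hn
  rw [increment_continuation hm hb hn hp]

/-- The fractional part of the preimage of `m` under the continuation is determined by the
relative position of `m` between consecutive values of `F`. -/
lemma fract_invFunOn_continuation {g : ℝ → ℝ} (hg : MapsTo g (Icc 0 1) (Icc 0 1))
    (hgh : RightInvOn g h (Icc 0 1)) {m t : ℕ} (ht : 1 ≤ t) (h1 : F t ≤ m)
    (h2 : m < F (t + 1)) :
    Int.fract (Function.invFunOn (continuation h) (Ici 1) (m : ℝ)) =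
      g (((m : ℝ) - F t) / F (t - 1)) := by
  set q := ((m : ℝ) - F t) / F (t - 1) with hq_def
  have h1' : (F t : ℝ) ≤ m := by exact_mod_cast h1
  have h2' : (m : ℝ) < F (t + 1) := by exact_mod_cast h2
  have hF := cast_F_pos (t - 1)
  rw [cast_F_succ ht] at h2'
  have hq : q ∈ Ico (0 : ℝ) 1 := by
    constructor
    · exact div_nonneg (by linarith) hF.le
    · rw [hq_def, div_lt_one hF]; linarith
  have hp := hg (Ico_subset_Icc_self hq)
  have hpq : h (g q) = q := hgh (Ico_subset_Icc_self hq)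
  have hp1 : g q ∈ Ico (0 : ℝ) 1 := by
    refine ⟨hp.1, lt_of_le_of_ne hp.2 fun e => ?_⟩
    rw [e, bijOn_strictMono_one hm hb] at hpq
    exact hq.2.ne hpq.symm
  have hmem : (t : ℝ) + g q ∈ Ici (1 : ℝ) := by
    have : (1 : ℝ) ≤ t := by exact_mod_cast ht
    simp only [mem_Ici]; linarith [hp.1]
  have hval : continuation h (t + g q) = m := by
    rw [continuation_add hp1, hpq, hq_def]; field_simp; ring
  rw [← hval, (bijOn_continuation hm hb).injOn.leftInvOn_invFunOn hmem, Int.fract_natCast_add]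
  exact Int.fract_eq_self.2 hp1

end Continuation

end ZeckendorfBlocks

/-! ### Densities and the distribution of relative positions -/

namespace ZeckendorfBlocks

open Real

open Classical in
/-- The proportion of the integers in `[1, n]` which satisfy `P`. -/
noncomputable def proportion (P : ℕ → Prop) (n : ℕ) : ℝ :=
  (((Finset.Icc 1 n).filter P).card : ℝ) / (n : ℝ)

lemma hasProb_iff {P : ℕ → Prop} {p : ℝ} :
    HasProb P p ↔ Tendsto (proportion P) atTop (𝓝 p) := Iff.rfl

lemma proportion_nonneg (P : ℕ → Prop) (n : ℕ) : 0 ≤ proportion P n := by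
  unfold proportion; positivity

lemma proportion_le_one (P : ℕ → Prop) (n : ℕ) : proportion P n ≤ 1 := by
  classical
  refine div_le_one_of_le₀ ?_ n.cast_nonneg
  have := Finset.card_filter_le (Finset.Icc 1 n) P
  rw [Nat.card_Icc, Nat.add_sub_cancel] at this
  exact_mod_cast this

lemma proportion_le_add {P Q : ℕ → Prop} {N : ℕ} (h : ∀ k ≥ N, P k → Q k) (n : ℕ) :
    proportion P n ≤ proportion Q n + N / n := by
  classical
  unfold proportion
  rw [← add_div]
  gcongr
  have : (Finset.Icc 1 n).filter P ⊆ (Finset.Icc 1 n).filter Q ∪ Finset.range N := by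
    intro k hk
    simp only [Finset.mem_filter, Finset.mem_union, Finset.mem_range] at hk ⊢
    rcases lt_or_ge k N with hN | hN
    · exact Or.inr hN
    · exact Or.inl ⟨hk.1, h k hN hk.2⟩
  have := (Finset.card_le_card this).trans (Finset.card_union_le _ _)
  rw [Finset.card_range] at this
  exact_mod_cast this

/-- Finitely many exceptions change the proportion by O(1/n). Only Q is assumed to have a density,
so this and its lower counterpart serve to squeeze P. -/
lemma HasProb.eventually_proportion_lt {P Q : ℕ → Prop} {p c : ℝ} (hQ : HasProb Q p)
    (h : ∀ᶠ k in atTop, P k → Q k) (hc : p < c) : ∀ᶠ n in atTop, proportion P n < c := by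
  obtain ⟨N, hN⟩ := eventually_atTop.1 h
  have := (hasProb_iff.1 hQ).add (tendsto_const_div_atTop_nhds_zero_nat (N : ℝ))
  rw [add_zero] at this
  filter_upwards [this.eventually_lt_const hc] with n hn
  exact (proportion_le_add hN n).trans_lt hn

lemma HasProb.eventually_lt_proportion {P Q : ℕ → Prop} {p c : ℝ} (hQ : HasProb Q p)
    (h : ∀ᶠ k in atTop, Q k → P k) (hc : c < p) : ∀ᶠ n in atTop, c < proportion P n := by
  obtain ⟨N, hN⟩ := eventually_atTop.1 h
  have := (hasProb_iff.1 hQ).sub (tendsto_const_div_atTop_nhds_zero_nat (N : ℝ))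
  rw [sub_zero] at this
  filter_upwards [this.eventually_const_lt hc] with n hn
  linarith [proportion_le_add hN n]

lemma fStar_zero (K : ℕ → ℕ) : fStar K 0 = 0 := by simp [fStar]

lemma fStar_one (K : ℕ → ℕ) : fStar K 1 = 1 := by simp [fStar]

/-- The greedy expansion shows that the choice defining `fStar` is not vacuous. Which expansion is
chosen is immaterial, since only its value y is used later; uniqueness is not needed. -/
lemma HasContinuousDistribution.exists_isCumulativeValue {K : ℕ → ℕ}
    (hK : HasContinuousDistribution K) {y : ℝ} (hy : y ∈ Ioo (0 : ℝ) 1) :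
    ∃ μ, IsZeckString μ ∧ unitValue μ = y ∧ IsCumulativeValue K μ (fStar K y) := by
  have hy' := Ioo_subset_Ico_self hy
  have hz := isZeckString_unitDigits hy'
  obtain ⟨l, hl⟩ := hK.2.1 _ hz rfl
  have h : ∃ l : ℝ, ∃ μ : ℕ → ℕ, IsZeckString μ ∧ μ 0 = 1 ∧ unitValue μ = y ∧
      IsCumulativeValue K μ l := ⟨l, _, hz, rfl, unitValue_unitDigits hy', hl⟩
  obtain ⟨μ, h1, -, h2, h3⟩ := Classical.epsilon_spec h
  refine ⟨μ, h1, h2, ?_⟩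
  rwa [fStar, if_neg hy.1.not_ge, if_neg hy.2.not_ge]

lemma HasContinuousDistribution.bijOn_fStar {K : ℕ → ℕ} (hK : HasContinuousDistribution K) :
    BijOn (fStar K) (Icc 0 1) (Icc 0 1) := by
  obtain ⟨-, -, hc, hm⟩ := hK
  refine ⟨fun x hx => ⟨?_, ?_⟩, hm.injOn, ?_⟩
  · rw [← fStar_zero K]; exact hm.monotoneOn (left_mem_Icc.2 zero_le_one) hx hx.1
  · rw [← fStar_one K]; exact hm.monotoneOn hx (right_mem_Icc.2 zero_le_one) hx.2
  · have := intermediate_value_Icc zero_le_one hc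
    rwa [fStar_zero, fStar_one] at this

/-- For large `k`, every leading block of `K k` of length `s` locates `x k`, the relative position
of `K k` between consecutive values of `F`. -/
lemma eventually_leadingBlock {K : ℕ → ℕ} (hK : Tendsto K atTop atTop) {x : ℕ → ℝ}
    (hx : ∀ k t, 1 ≤ t → F t ≤ K k → K k < F (t + 1) → x k = ((K k : ℝ) - F t) / F (t - 1))
    (s : ℕ) {ε : ℝ} (hε : 0 < ε) :
    ∀ᶠ k in atTop, (∃ b, IsLeadingBlock s (K k) b) ∧ ∀ b, IsLeadingBlock s (K k) b →
      |x k - goldenRatio * (dot b - 1)| ≤ 5 * goldenRatio⁻¹ ^ s + ε := by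
  have hlim : Tendsto (fun t : ℕ => 8 / (F t : ℝ)) atTop (𝓝 0) :=
    (tendsto_natCast_atTop_atTop.comp tendsto_F).const_div_atTop 8
  obtain ⟨T, hT⟩ := eventually_atTop.1 (hlim.eventually_lt_const hε)
  -- This threshold forces t ≥ s + T + 2, so a block of length s exists and t - 1 ≥ T.
  filter_upwards [hK.eventually_ge_atTop (F (s + T + 2))] with k hk
  obtain ⟨t, ht, h1, h2⟩ := exists_F_le_lt ((F_pos _).trans_le hk)
  have hst : s + T + 2 ≤ t := by
    by_contra hlt
    have := F_mono (show t + 1 ≤ s + T + 2 by omega)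
    omega
  refine ⟨exists_isLeadingBlock ht h1 h2 (by omega), fun b hb => ?_⟩
  rw [hx k t ht h1 h2]
  linarith [hb.abs_position_sub_le ht h1 h2, hT (t - 1) (by omega)]

/-- `{k : x k ≤ y}` has density `f_K^* (y)`. -/
theorem HasContinuousDistribution.hasProb_fStar_le {K : ℕ → ℕ} (hK : HasContinuousDistribution K)
    {x : ℕ → ℝ} (hx01 : ∀ᶠ k in atTop, x k ∈ Icc (0 : ℝ) 1)
    (hx : ∀ k t, 1 ≤ t → F t ≤ K k → K k < F (t + 1) → x k = ((K k : ℝ) - F t) / F (t - 1))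
    {β : ℝ} (hβ : β ∈ Icc (0 : ℝ) 1) : HasProb (fun k => fStar K (x k) ≤ β) β := by
  have hb := hK.bijOn_fStar
  have hm := hK.2.2.2
  obtain ⟨y, hy, rfl⟩ := hb.surjOn hβ
  -- Two truncation errors of 5ω^s each occur, one for the block of K_k and one for μ.
  have small : ∀ δ > 0, ∃ s₀, ∀ s ≥ s₀, 10 * goldenRatio⁻¹ ^ s < δ := fun δ hδ => by
    have : Tendsto (fun s : ℕ => 10 * goldenRatio⁻¹ ^ s) atTop (𝓝 0) := by
      simpa using tendsto_inv_goldenRatio_pow.const_mul 10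
    exact eventually_atTop.1 (this.eventually_lt_const hδ)
  rw [hasProb_iff, tendsto_order]
  constructor
  · intro c hc
    rcases lt_or_ge c 0 with hc0 | hc0
    · exact Eventually.of_forall fun n => hc0.trans_le (proportion_nonneg _ n)
    -- A level strictly between c and f_K^*(y) is attained at some z < y. Half of the gap y - z
    -- absorbs the truncation errors and half the error ε, so blocks up to μ|s force x k ≤ y.
    obtain ⟨c', hcc', hc'⟩ := exists_between hc
    obtain ⟨z, hz, rfl⟩ := hb.surjOn ⟨hc0.trans hcc'.le, hc'.le.trans (hb.mapsTo hy).2⟩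
    have hzy : z < y := (hm.lt_iff_lt hz hy).1 hc'
    -- At the endpoints `fStar` is set by convention and is not a limit of block probabilities.
    have hz0 : 0 < z := by
      refine lt_of_le_of_ne hz.1 ?_
      rintro rfl
      rw [fStar_zero] at hcc'; linarith
    obtain ⟨μ, hμ, hμz, p, hp, hpl⟩ := hK.exists_isCumulativeValue ⟨hz0, hzy.trans_le hy.2⟩
    obtain ⟨s₀, hs₀⟩ := small ((y - z) / 2) (by linarith)
    obtain ⟨s, hsc, hs, hs2⟩ := ((hpl.eventually_const_lt hcc').and
      ((eventually_ge_atTop s₀).and (eventually_ge_atTop 2))).exists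
    refine (hp s hs2).eventually_lt_proportion ?_ hsc
    filter_upwards [hx01, eventually_leadingBlock hK.1.2.1 hx s
      (show 0 < (y - z) / 2 by linarith)] with k hk hks
    rintro ⟨b, hbk, hle⟩
    have h1 := abs_le.1 (hks.2 b hbk)
    have h2 := abs_le.1 (abs_unitValue_sub_le hμ.1 s)
    have h3 : dot b ≤ dot (trunc μ s) := by
      rcases hle with rfl | h
      · exact le_rfl
      · exact h.le
    have h4 := mul_le_mul_of_nonneg_left (sub_le_sub_right h3 1) goldenRatio_pos.le
    have h5 := hs₀ s hs
    exact hm.monotoneOn hk hy (by linarith)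
  · intro c hc
    rcases lt_or_ge 1 c with hc1 | hc1
    · exact Eventually.of_forall fun n => (proportion_le_one _ n).trans_lt hc1
    obtain ⟨c', hc', hcc'⟩ := exists_between hc
    obtain ⟨z, hz, rfl⟩ := hb.surjOn ⟨(hb.mapsTo hy).1.trans hc'.le, hcc'.le.trans hc1⟩
    have hyz : y < z := (hm.lt_iff_lt hy hz).1 hc'
    have hz1 : z < 1 := by
      refine lt_of_le_of_ne hz.2 ?_
      rintro rfl
      rw [fStar_one] at hcc'; linarith
    obtain ⟨μ, hμ, hμz, p, hp, hpl⟩ := hK.exists_isCumulativeValue ⟨hy.1.trans_lt hyz, hz1⟩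
    obtain ⟨s₀, hs₀⟩ := small ((z - y) / 2) (by linarith)
    obtain ⟨s, hsc, hs, hs2⟩ := ((hpl.eventually_lt_const hcc').and
      ((eventually_ge_atTop s₀).and (eventually_ge_atTop 2))).exists
    refine (hp s hs2).eventually_proportion_lt ?_ hsc
    filter_upwards [hx01, eventually_leadingBlock hK.1.2.1 hx s
      (show 0 < (z - y) / 2 by linarith)] with k hk hks hky
    -- The event to be reached requires a leading block of length s to exist, which holds for large
    -- k.
    obtain ⟨b, hbk⟩ := hks.1
    have h0 : x k ≤ y := (hm.le_iff_le hk hy).1 hky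
    refine ⟨b, hbk, Or.inr ?_⟩
    have h1 := abs_le.1 (hks.2 b hbk)
    have h2 := abs_le.1 (abs_unitValue_sub_le hμ.1 s)
    have h5 := hs₀ s hs
    have h4 : goldenRatio * (dot b - 1) < goldenRatio * (dot (trunc μ s) - 1) := by linarith
    linarith [lt_of_mul_lt_mul_left h4 goldenRatio_pos.le]

end ZeckendorfBlocks

/-! ### Proof of the main theorem -/

theorem theorem4p11 (K : ℕ → ℕ) (hK : ZeckendorfBlocks.HasContinuousDistribution K) :
    ∃ f : ℝ → ℝ,
      ZeckendorfBlocks.IsUniformContinuation ZeckendorfBlocks.F f ∧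
      -- `f_∞ : [0, 1] → [0, 1]` is a bijection with inverse `f_K^*`
      Set.BijOn (ZeckendorfBlocks.limitIncrement f) (Set.Icc 0 1) (Set.Icc 0 1) ∧
      (∀ y ∈ Set.Icc (0 : ℝ) 1,
        Function.invFunOn (ZeckendorfBlocks.limitIncrement f) (Set.Icc 0 1) y =
          ZeckendorfBlocks.fStar K y) ∧
      -- `f : [1, ∞) → [1, ∞)` is an increasing bijection, so that `f⁻¹ (K_n)` makes sense
      StrictMonoOn f (Set.Ici 1) ∧ Set.BijOn f (Set.Ici 1) (Set.Ici 1) ∧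
      ZeckendorfBlocks.FractEquidistributed
        (fun n => Function.invFunOn f (Set.Ici 1) (K n : ℝ)) := by
  have hg := hK.bijOn_fStar
  have hgm := hK.2.2.2
  set g := ZeckendorfBlocks.fStar K
  let h := Function.invFunOn g (Icc 0 1)
  have hinv : InvOn h g (Icc 0 1) (Icc 0 1) := hg.invOn_invFunOn
  have hb : BijOn h (Icc 0 1) (Icc 0 1) := hg.symm hinv.symm
  have hm : StrictMonoOn h (Icc 0 1) := fun x hx y hy hxy => by
    rw [← hgm.lt_iff_lt (hb.mapsTo hx) (hb.mapsTo hy), hinv.2 hx, hinv.2 hy]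
    exact hxy
  have hlim : EqOn h (ZeckendorfBlocks.limitIncrement (ZeckendorfBlocks.continuation h))
      (Icc 0 1) := fun p hp => (ZeckendorfBlocks.limitIncrement_continuation hm hb hp).symm
  have hbl := hb.congr hlim
  refine ⟨ZeckendorfBlocks.continuation h,
    ZeckendorfBlocks.isUniformContinuation_continuation hm hb, hbl, fun y hy => ?_,
    ZeckendorfBlocks.strictMonoOn_continuation hm hb,
    ZeckendorfBlocks.bijOn_continuation hm hb, fun β hβ => ?_⟩
  · have : ZeckendorfBlocks.limitIncrement (ZeckendorfBlocks.continuation h) (g y) = y := by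
      rw [← hlim (hg.mapsTo hy), hinv.1 hy]
    conv_lhs => rw [← this]
    exact hbl.injOn.leftInvOn_invFunOn (hg.mapsTo hy)
  · -- the relative position of `K k` is recovered from the fractional part by `h`
    set r : ℕ → ℝ := fun k =>
      Int.fract (Function.invFunOn (ZeckendorfBlocks.continuation h) (Ici 1) (K k : ℝ)) with hr
    have hr01 : ∀ k, r k ∈ Icc (0 : ℝ) 1 := fun k =>
      ⟨Int.fract_nonneg _, (Int.fract_lt_one _).le⟩
    have key := hK.hasProb_fStar_le (x := fun k => h (r k))
      (Eventually.of_forall fun k => hb.mapsTo (hr01 k)) (fun k t ht h1 h2 => ?_) hβ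
    -- As f_K^* undoes h, the event f_K^*(h(r k)) ≤ β is the event r k ≤ β.
    · simpa only [show ∀ k, ZeckendorfBlocks.fStar K (h (r k)) = r k from
        fun k => hinv.2 (hr01 k)] using key
    · have hF := ZeckendorfBlocks.cast_F_pos (t - 1)
      have h1' : (ZeckendorfBlocks.F t : ℝ) ≤ K k := by exact_mod_cast h1
      have h2' : (K k : ℝ) < ZeckendorfBlocks.F (t + 1) := by exact_mod_cast h2
      rw [ZeckendorfBlocks.cast_F_succ ht] at h2'
      simp only [hr]
      rw [ZeckendorfBlocks.fract_invFunOn_continuation hm hb hg.mapsTo hinv.1 ht h1 h2]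
      refine hinv.1 ⟨div_nonneg (by linarith) hF.le, ?_⟩
      rw [div_le_one hF]
      linarith
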